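/- Let $d \ge 2$ be an even integer and let $$M_d = \{(\cos\theta, \cos 2\theta, \dots, \cos \tfrac d2\theta, \sin\theta, \sin 2\theta, \dots, \sin\tfrac d2\theta) : \theta \in [0,2\pi)\} \subset \mathbb{R}^d$$ be the trigonometric moment curve. Then $M_d$ is a real algebraic variety (the set of common real zeros of a set of polynomials in $\mathbb{R}[x_1,\dots,x_d]$), and: - (Hilbert function) for every integer $n \ge 0$, $$\mathrm{HF}_{M_d}(n) := \dim_{\mathbb{R}}\left(\mathbb{R}_{\le n}[x] / I_{\le n}(M_d)\right) = nd+1,$$ where $\mathbb{R}_{\le n}[x]$ is the space of real polynomials in $x_1,\dots,x_d$ of total degree at most $n$, and $I_{\le n}(M_d)$ is its subspace of polynomials that vanish on $M_d$; - (Dimension) $\dim M_d = 1$, where the dimension is the largest $r$ for which there is a chain $V_0 \subsetneq V_1 \subsetneq \dots \subsetneq V_r$ of irreducible subvarieties of $M_d$; - (Degree) $\deg M_d = d$, that is, an affine subspace of $\mathbb{C}^d$ of codimension $\dim M_d = 1$ in general position meets the complexification of $M_d$ (the subscheme of $\mathbb{C}^d$ defined by the vanishing ideal $I(M_d)$) in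 finitely many points, and in exactly $d$ points when they are counted with intersection multiplicity. Here "in general position" means: for all coefficients of the equation of the subspace outside the zero set of some nonzero complex polynomial in them. -/

import Mathlib

noncomputable section

namespace RealVariety

open MvPolynomial

/-- A real algebraic variety in `ℝ^d`: the set of common zeros of a set of polynomials. -/
def IsVariety {d : ℕ} (V : Set (Fin d → ℝ)) : Prop :=
  ∃ P : Set (MvPolynomial (Fin d) ℝ), V = {x | ∀ p ∈ P, eval x p = 0}

/-- An irreducible variety: nonempty, and not the union of two proper subvarieties. -/
def IsIrreducibleVariety {d : ℕ} (W : Set (Fin d → ℝ)) : Prop :=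
  IsVariety W ∧ W.Nonempty ∧
    ∀ A B : Set (Fin d → ℝ), IsVariety A → IsVariety B → W = A ∪ B → W = A ∨ W = B

/-- The dimension of `V`: the supremum of the `r` for which there is a chain
`V₀ ⊊ V₁ ⊊ ⋯ ⊊ V_r` of irreducible subvarieties of `V` (and `⊥` if `V` is empty). -/
def dim {d : ℕ} (V : Set (Fin d → ℝ)) : WithBot ℕ∞ :=
  Order.krullDim {W : Set (Fin d → ℝ) // IsIrreducibleVariety W ∧ W ⊆ V}

/-- The vanishing ideal `I(V) ⊆ ℝ[x₁, …, x_d]`. -/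
abbrev ideal {d : ℕ} (V : Set (Fin d → ℝ)) : Ideal (MvPolynomial (Fin d) ℝ) :=
  vanishingIdeal ℝ V

/-- The (affine) Hilbert function `n ↦ dim (ℝ_{≤ n}[x] / I_{≤ n}(V))`. -/
def hilbertFunction {d : ℕ} (V : Set (Fin d → ℝ)) (n : ℕ) : ℕ :=
  Module.finrank ℝ
    (restrictTotalDegree (Fin d) ℝ n ⧸
      ((ideal V).restrictScalars ℝ).submoduleOf (restrictTotalDegree (Fin d) ℝ n))

/-- The affine-linear polynomial `∑ j, a j * z_j - b` over `ℂ`. -/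
def affineForm {d : ℕ} (a : Fin d → ℂ) (b : ℂ) : MvPolynomial (Fin d) ℂ :=
  ∑ j, C (a j) * X j - C b

/-- The ideal in `ℂ[z₁, …, z_d]` of the scheme-theoretic intersection of the complexification
of `V` (the subscheme of `ℂ^d` cut out by the real polynomials in `I(V)`) with the affine
subspace `{z | A z = b}`. -/
def sectionIdeal {d r : ℕ} (V : Set (Fin d → ℝ)) (A : Fin r → Fin d → ℂ) (b : Fin r → ℂ) :
    Ideal (MvPolynomial (Fin d) ℂ) :=
  (ideal V).map (MvPolynomial.map (algebraMap ℝ ℂ)) ⊔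
    Ideal.span (Set.range fun i => affineForm (A i) (b i))

/-- The multiplicity at `z` of the subscheme of `ℂ^d` defined by `J`: the length of its local
ring `𝒪_z / J 𝒪_z`, where `𝒪_z`, the local ring of `ℂ^d` at `z`, is the localization of
`ℂ[z₁, …, z_d]` at the maximal ideal of the polynomials that vanish at `z`. -/
def localMultiplicity {d : ℕ} (J : Ideal (MvPolynomial (Fin d) ℂ)) (z : Fin d → ℂ) : ℕ∞ :=
  Module.length (Localization.AtPrime (vanishingIdeal ℂ {z} : Ideal (MvPolynomial (Fin d) ℂ)))
    (Localization.AtPrime (vanishingIdeal ℂ {z} : Ideal (MvPolynomial (Fin d) ℂ)) ⧸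
      J.map (algebraMap (MvPolynomial (Fin d) ℂ)
        (Localization.AtPrime (vanishingIdeal ℂ {z} : Ideal (MvPolynomial (Fin d) ℂ)))))

/-- `V` has degree `m`: with `r = dim V`, an affine subspace `{z | A z = b}` of `ℂ^d` of
codimension `r` in general position (all `(A, b)` outside the zero set of some nonzero
polynomial `Q` in their entries) meets the complexification of `V` in finitely many points,
`m` in number when counted with intersection multiplicity. -/
def HasDegree {d : ℕ} (V : Set (Fin d → ℝ)) (m : ℕ) : Prop :=
  ∃ r : ℕ, dim V = r ∧
    ∃ Q : MvPolynomial ((Fin r × Fin d) ⊕ Fin r) ℂ, Q ≠ 0 ∧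
      ∀ (A : Fin r → Fin d → ℂ) (b : Fin r → ℂ),
        eval (Sum.elim (fun ij => A ij.1 ij.2) b) Q ≠ 0 →
          LinearIndependent ℂ A ∧
          (zeroLocus ℂ (sectionIdeal V A b)).Finite ∧
          ∑ᶠ z ∈ zeroLocus ℂ (sectionIdeal V A b),
            localMultiplicity (sectionIdeal V A b) z = m

/-- The point `(cos θ, cos 2θ, …, cos (d/2)θ, sin θ, sin 2θ, …, sin (d/2)θ)` of `ℝ^d`,
for even `d`. -/
def trigMoment (d : ℕ) (θ : ℝ) : Fin d → ℝ := fun i =>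
  if (i : ℕ) < d / 2 then Real.cos (((i : ℕ) + 1 : ℝ) * θ)
  else Real.sin ((((i : ℕ) - d / 2 : ℕ) + 1 : ℝ) * θ)

/-- The trigonometric moment curve `M_d ⊆ ℝ^d`, for even `d`. -/
def trigMomentCurve (d : ℕ) : Set (Fin d → ℝ) :=
  trigMoment d '' Set.Ico 0 (2 * Real.pi)

end RealVariety

end

/-! Substituting `T = exp (i θ)` turns the coordinates of the curve into Laurent polynomials in `T`.
A nonzero Laurent polynomial has finitely many zeros, so the vanishing ideal is the kernel of
`paramReal`, and its complexification is the kernel of `param` (`map_ideal_trigMomentCurve`). As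
`param` is onto (`param_surjective`), the complexified curve is a copy of `ℂˣ`, and everything
reduces to Laurent polynomials.

Variety: the circle relation and the addition formulas lie in the ideal and already cut out the
curve. Hilbert function: polynomials of degree at most `n` restrict exactly to the real
trigonometric polynomials of degree at most `n * (d / 2)` (`paramImage_eq_trigSpan`), a space of
dimension `2 * (n * (d / 2)) + 1`. Dimension: proper subvarieties of the curve are finite, so the
irreducible ones are points. Degree: a hyperplane restricts to a Laurent polynomial with exponents
between `-d / 2` and `d / 2`. If both extreme coefficients are nonzero, multiplication by `T ^ (d /
2)` gives a polynomial of degree `d` with no root at `0`, and its root multiplicities are the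
intersection multiplicities (`finsum_localMultiplicity`). -/

noncomputable section

namespace RealVariety

open LaurentPolynomial (T)

/-! ### Cosines and sines as Laurent polynomials. -/

/-- The Laurent polynomial `(T ^ k + T ^ (-k)) / 2`, which is `cos (k θ)` at `T = exp (i θ)`. -/
def cosL (k : ℤ) : LaurentPolynomial ℂ := (1 / 2 : ℂ) • (T k + T (-k))

/-- The Laurent polynomial `(T ^ k - T ^ (-k)) / (2 i)`, which is `sin (k θ)` at
`T = exp (i θ)`. -/
def sinL (k : ℤ) : LaurentPolynomial ℂ := (-Complex.I / 2) • (T k - T (-k))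

/-- The coordinates of the trigonometric moment curve as Laurent polynomials. -/
def coord (d : ℕ) (i : Fin d) : LaurentPolynomial ℂ :=
  if (i : ℕ) < d / 2 then cosL ((i : ℕ) + 1) else sinL (((i : ℕ) - d / 2 : ℕ) + 1)

/-- The rational parametrization of the complexified trigonometric moment curve. -/
def param (d : ℕ) : MvPolynomial (Fin d) ℂ →ₐ[ℂ] LaurentPolynomial ℂ :=
  MvPolynomial.aeval (coord d)

/-- The restriction of `param` to polynomials with real coefficients. -/
def paramReal (d : ℕ) : MvPolynomial (Fin d) ℝ →ₐ[ℝ] LaurentPolynomial ℂ :=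
  MvPolynomial.aeval (coord d)

/-- Evaluation of a Laurent polynomial at a nonzero complex number. -/
def evalAt (t : ℂˣ) : LaurentPolynomial ℂ →ₐ[ℂ] ℂ :=
  { LaurentPolynomial.eval₂ (RingHom.id ℂ) t with
    commutes' := fun r => LaurentPolynomial.eval₂_C (RingHom.id ℂ) t r }

/-- The point of the complexified curve with parameter `t`. -/
def point (d : ℕ) (t : ℂˣ) : Fin d → ℂ := fun i => evalAt t (coord d i)

/-- The complex number `exp (i θ)` as a unit. -/
def expUnit (θ : ℝ) : ℂˣ := Units.mk0 (Complex.exp (θ * Complex.I)) (Complex.exp_ne_zero _)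

@[simp] lemma evalAt_T (t : ℂˣ) (n : ℤ) : evalAt t (T n) = ((t ^ n : ℂˣ) : ℂ) :=
  LaurentPolynomial.eval₂_T _ _ _

@[simp] lemma evalAt_toLaurent (t : ℂˣ) (p : Polynomial ℂ) :
    evalAt t (Polynomial.toLaurent p) = p.eval (t : ℂ) :=
  LaurentPolynomial.eval₂_toLaurent _ _ _

lemma cosL_neg (k : ℤ) : cosL (-k) = cosL k := by simp [cosL, add_comm]

lemma sinL_neg (k : ℤ) : sinL (-k) = -sinL k := by
  simp only [sinL, neg_neg, ← smul_neg, neg_sub]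

lemma cosL_zero : cosL 0 = 1 := by
  simp only [cosL, neg_zero, LaurentPolynomial.T_zero, ← two_smul ℂ (1 : LaurentPolynomial ℂ),
    smul_smul]
  norm_num

lemma sinL_zero : sinL 0 = 0 := by simp [sinL]

lemma cosL_add_I_smul_sinL (k : ℤ) : cosL k + Complex.I • sinL k = T k := by
  have h : Complex.I * (-Complex.I / 2) = 1 / 2 := by
    linear_combination (-1 / 2 : ℂ) * Complex.I_mul_I
  rw [cosL, sinL, smul_smul, h, ← smul_add, add_add_sub_cancel, ← two_smul ℂ, smul_smul]
  norm_num

lemma cosL_sub_I_smul_sinL (k : ℤ) : cosL k - Complex.I • sinL k = T (-k) := by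
  rw [← cosL_add_I_smul_sinL, cosL_neg, sinL_neg, smul_neg, sub_eq_add_neg]

lemma cosL_eq (k : ℤ) : cosL k = LaurentPolynomial.C (1 / 2) * (T k + T (-k)) := by
  rw [cosL, LaurentPolynomial.smul_eq_C_mul]

lemma sinL_eq (k : ℤ) : sinL k = LaurentPolynomial.C (-Complex.I / 2) * (T k - T (-k)) := by
  rw [sinL, LaurentPolynomial.smul_eq_C_mul]

lemma C_neg_I_div_two_mul_self :
    (LaurentPolynomial.C (-Complex.I / 2) : LaurentPolynomial ℂ) *
      LaurentPolynomial.C (-Complex.I / 2) =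
    -(LaurentPolynomial.C (1 / 2) * LaurentPolynomial.C (1 / 2)) := by
  rw [← map_mul, ← map_mul, ← map_neg]
  congr 1
  linear_combination (1 / 4 : ℂ) * Complex.I_mul_I

lemma C_half_mul_two (x : LaurentPolynomial ℂ) :
    LaurentPolynomial.C (1 / 2) * (x + x) = x := by
  rw [← LaurentPolynomial.smul_eq_C_mul, ← two_smul ℂ, smul_smul]
  norm_num

lemma cosL_add (j k : ℤ) : cosL (j + k) = cosL j * cosL k - sinL j * sinL k := by
  rw [← C_half_mul_two (cosL (j + k))]
  simp only [cosL_eq, sinL_eq, neg_add, LaurentPolynomial.T_add]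
  linear_combination ((T j - T (-j)) * (T k - T (-k)) : LaurentPolynomial ℂ) *
    C_neg_I_div_two_mul_self

lemma sinL_add (j k : ℤ) : sinL (j + k) = sinL j * cosL k + cosL j * sinL k := by
  rw [← C_half_mul_two (sinL (j + k))]
  simp only [cosL_eq, sinL_eq, neg_add, LaurentPolynomial.T_add]
  ring

lemma evalAt_expUnit_T (θ : ℝ) (k : ℤ) :
    evalAt (expUnit θ) (T k) = Complex.exp (k * θ * Complex.I) := by
  rw [evalAt_T, Units.val_zpow_eq_zpow_val, expUnit, Units.val_mk0, ← Complex.exp_int_mul,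
    mul_assoc]

lemma evalAt_expUnit_cosL (θ : ℝ) (k : ℤ) :
    evalAt (expUnit θ) (cosL k) = (Real.cos (k * θ) : ℝ) := by
  rw [cosL, map_smul, map_add, evalAt_expUnit_T, evalAt_expUnit_T, Complex.ofReal_cos, Complex.cos]
  push_cast
  rw [smul_eq_mul]
  ring_nf

lemma evalAt_expUnit_sinL (θ : ℝ) (k : ℤ) :
    evalAt (expUnit θ) (sinL k) = (Real.sin (k * θ) : ℝ) := by
  rw [sinL, map_smul, map_sub, evalAt_expUnit_T, evalAt_expUnit_T, Complex.ofReal_sin, Complex.sin]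
  push_cast
  rw [smul_eq_mul]
  ring_nf

lemma evalAt_expUnit_coord (d : ℕ) (θ : ℝ) (i : Fin d) :
    evalAt (expUnit θ) (coord d i) = (trigMoment d θ i : ℝ) := by
  rw [coord, trigMoment]
  split_ifs
  · rw [evalAt_expUnit_cosL]; push_cast; rfl
  · rw [evalAt_expUnit_sinL]; push_cast; rfl

lemma evalAt_param (d : ℕ) (t : ℂˣ) (p : MvPolynomial (Fin d) ℂ) :
    evalAt t (param d p) = MvPolynomial.aeval (point d t) p := by
  rw [param, ← AlgHom.comp_apply, MvPolynomial.comp_aeval]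
  rfl

lemma evalAt_paramReal (d : ℕ) (θ : ℝ) (p : MvPolynomial (Fin d) ℝ) :
    evalAt (expUnit θ) (paramReal d p) = (MvPolynomial.aeval (trigMoment d θ) p : ℝ) := by
  have h : ((evalAt (expUnit θ)).restrictScalars ℝ).comp (paramReal d) =
      (Complex.ofRealAm).comp (MvPolynomial.aeval (trigMoment d θ)) := by
    ext i
    simp only [AlgHom.comp_apply, paramReal, MvPolynomial.aeval_X]
    exact evalAt_expUnit_coord d θ i
  exact DFunLike.congr_fun h p

lemma param_map (d : ℕ) (p : MvPolynomial (Fin d) ℝ) :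
    param d (MvPolynomial.map (algebraMap ℝ ℂ) p) = paramReal d p :=
  MvPolynomial.aeval_map_algebraMap ℂ _ _

/-! ### The vanishing ideal and its complexification. -/

lemma finite_setOf_evalAt_eq_zero {f : LaurentPolynomial ℂ} (hf : f ≠ 0) :
    {t : ℂˣ | evalAt t f = 0}.Finite := by
  obtain ⟨n, p, hp⟩ := f.exists_T_pow
  have hp0 : p ≠ 0 := by
    rintro rfl
    rw [map_zero] at hp
    exact hf ((LaurentPolynomial.isUnit_T (n : ℤ)).mul_left_eq_zero.mp hp.symm)
  refine Set.Finite.of_finite_image (f := Units.val) ?_ Units.val_injective.injOn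
  refine (Polynomial.finite_setOfPred_isRoot hp0).subset ?_
  rintro _ ⟨t, ht, rfl⟩
  have ht : evalAt t f = 0 := ht
  have := congrArg (evalAt t) hp
  rw [evalAt_toLaurent, map_mul, ht, zero_mul] at this
  exact this

lemma expUnit_injOn : Set.InjOn expUnit (Set.Ico 0 (2 * Real.pi)) := by
  intro θ hθ φ hφ h
  have h : Complex.exp (θ * Complex.I) = Complex.exp (φ * Complex.I) := congrArg Units.val h
  obtain ⟨n, hn⟩ := Complex.exp_eq_exp_iff_exists_int.mp h
  have hn' : θ = φ + n * (2 * Real.pi) := by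
    have : (θ : ℂ) * Complex.I = (φ + n * (2 * Real.pi)) * Complex.I := by rw [hn]; ring
    exact_mod_cast mul_right_cancel₀ Complex.I_ne_zero this
  have hpi := Real.pi_pos
  have h1 : (n : ℝ) < 1 := by
    by_contra! hc
    nlinarith [hθ.2, hφ.1]
  have h2 : (-1 : ℝ) < n := by
    by_contra! hc
    nlinarith [hθ.1, hφ.2]
  have : n = 0 := by
    have h1 : n < 1 := by exact_mod_cast h1
    have h2 : -1 < n := by exact_mod_cast h2
    omega
  simpa [this] using hn'

lemma finite_setOf_aeval_trigMoment_eq_zero {d : ℕ} {p : MvPolynomial (Fin d) ℝ}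
    (hp : paramReal d p ≠ 0) :
    {θ ∈ Set.Ico 0 (2 * Real.pi) | MvPolynomial.aeval (trigMoment d θ) p = 0}.Finite := by
  refine Set.Finite.of_finite_image (f := expUnit) ?_ (expUnit_injOn.mono fun θ h => h.1)
  refine (finite_setOf_evalAt_eq_zero hp).subset ?_
  rintro _ ⟨θ, hθ, rfl⟩
  rw [Set.mem_ofPred, evalAt_paramReal, hθ.2, Complex.ofReal_zero]

lemma infinite_Ico_zero_two_pi : (Set.Ico 0 (2 * Real.pi)).Infinite :=
  Set.Ico_infinite (by positivity)

/-- The values of `p` on the curve are those of `paramReal d p` on the unit circle, an infinite set,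
and a nonzero Laurent polynomial has only finitely many zeros. -/
lemma mem_ideal_trigMomentCurve_iff {d : ℕ} {p : MvPolynomial (Fin d) ℝ} :
    p ∈ ideal (trigMomentCurve d) ↔ paramReal d p = 0 := by
  rw [MvPolynomial.mem_vanishingIdeal_iff]
  constructor
  · intro h
    by_contra hp
    refine infinite_Ico_zero_two_pi ((finite_setOf_aeval_trigMoment_eq_zero hp).subset ?_)
    exact fun θ hθ => ⟨hθ, h _ ⟨θ, hθ, rfl⟩⟩
  · rintro h _ ⟨θ, -, rfl⟩
    have := evalAt_paramReal d θ p
    rw [h, map_zero] at this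
    exact_mod_cast this.symm

lemma exists_eq_map_add_C_I_mul_map {σ : Type*} (p : MvPolynomial σ ℂ) :
    ∃ q r : MvPolynomial σ ℝ, p = MvPolynomial.map (algebraMap ℝ ℂ) q +
      MvPolynomial.C Complex.I * MvPolynomial.map (algebraMap ℝ ℂ) r := by
  induction p using MvPolynomial.induction_on with
  | C a =>
    refine ⟨MvPolynomial.C a.re, MvPolynomial.C a.im, ?_⟩
    rw [MvPolynomial.map_C, MvPolynomial.map_C, ← map_mul, ← map_add]
    congr 1
    rw [mul_comm]
    exact (Complex.re_add_im a).symm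
  | add p q hp hq =>
    obtain ⟨q₁, r₁, rfl⟩ := hp
    obtain ⟨q₂, r₂, rfl⟩ := hq
    exact ⟨q₁ + q₂, r₁ + r₂, by simp only [map_add]; ring⟩
  | mul_X p i hp =>
    obtain ⟨q₁, r₁, rfl⟩ := hp
    exact ⟨q₁ * MvPolynomial.X i, r₁ * MvPolynomial.X i, by
      simp only [map_mul, MvPolynomial.map_X]; ring⟩

lemma map_ideal_trigMomentCurve (d : ℕ) :
    (ideal (trigMomentCurve d)).map (MvPolynomial.map (algebraMap ℝ ℂ)) =
      RingHom.ker (param d) := by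
  apply le_antisymm
  · rw [Ideal.map_le_iff_le_comap]
    intro p hp
    rw [Ideal.mem_comap, RingHom.mem_ker, param_map, mem_ideal_trigMomentCurve_iff.mp hp]
  · intro p hp
    rw [RingHom.mem_ker] at hp
    obtain ⟨q, r, rfl⟩ := exists_eq_map_add_C_I_mul_map p
    -- At a real point of the curve `q` and `r` take real values, so `q + i r = 0` forces both to
    -- vanish.
    have key : ∀ θ, MvPolynomial.aeval (trigMoment d θ) q = 0 ∧
        MvPolynomial.aeval (trigMoment d θ) r = 0 := by
      intro θ
      have := congrArg (evalAt (expUnit θ)) hp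
      rw [map_add, map_add, map_mul, map_mul, param_map, param_map, evalAt_paramReal,
        evalAt_paramReal, evalAt_param, MvPolynomial.aeval_C, map_zero] at this
      simpa [Complex.ext_iff] using this
    refine Ideal.add_mem _ (Ideal.mem_map_of_mem _ ?_)
      (Ideal.mul_mem_left _ _ (Ideal.mem_map_of_mem _ ?_)) <;>
    · rw [MvPolynomial.mem_vanishingIdeal_iff]
      rintro _ ⟨θ, -, rfl⟩
      first | exact (key θ).1 | exact (key θ).2

lemma coord_cos {d : ℕ} {k : ℕ} (hk : k < d / 2) :
    coord d ⟨k, by omega⟩ = cosL ((k : ℤ) + 1) := by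
  simp [coord, hk]

lemma coord_sin {d : ℕ} {k : ℕ} (hk : d / 2 + k < d) :
    coord d ⟨d / 2 + k, hk⟩ = sinL ((k : ℤ) + 1) := by
  simp [coord]

/-- The first harmonics generate the Laurent ring, since `cos θ ± i sin θ` are `T` and its inverse.
-/
lemma param_surjective {d : ℕ} (hd : 1 < d) : Function.Surjective (param d) := by
  have hx : cosL 1 ∈ (param d).range :=
    ⟨MvPolynomial.X ⟨0, by omega⟩, by
      simpa [param] using coord_cos (d := d) (k := 0) (by omega)⟩
  have hy : sinL 1 ∈ (param d).range :=
    ⟨MvPolynomial.X ⟨d / 2 + 0, by omega⟩, by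
      simpa [param] using coord_sin (d := d) (k := 0) (by omega)⟩
  have hT : T 1 ∈ (param d).range := by
    rw [← cosL_add_I_smul_sinL]
    exact add_mem hx (Subalgebra.smul_mem _ hy _)
  have hT' : T (-1) ∈ (param d).range := by
    rw [← cosL_sub_I_smul_sinL]
    exact sub_mem hx (Subalgebra.smul_mem _ hy _)
  intro f
  change f ∈ (param d).range
  induction f using LaurentPolynomial.induction_on' with
  | add p q hp hq => exact add_mem hp hq
  | C_mul_T n a =>
    rw [← LaurentPolynomial.smul_eq_C_mul]
    refine Subalgebra.smul_mem _ ?_ _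
    obtain ⟨n, rfl | rfl⟩ := n.eq_nat_or_neg
    · simpa using pow_mem hT n
    · simpa [LaurentPolynomial.T_pow] using pow_mem hT' n

/-! ### The curve is a variety. -/

lemma trigMoment_cos {d k : ℕ} (θ : ℝ) (hk : k < d / 2) :
    trigMoment d θ ⟨k, by omega⟩ = Real.cos ((k + 1 : ℝ) * θ) := by
  simp [trigMoment, hk]

lemma trigMoment_sin {d k : ℕ} (θ : ℝ) (hk : d / 2 + k < d) :
    trigMoment d θ ⟨d / 2 + k, hk⟩ = Real.sin ((k + 1 : ℝ) * θ) := by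
  simp [trigMoment]

lemma exists_angle {x y : ℝ} (h : x ^ 2 + y ^ 2 = 1) :
    ∃ θ ∈ Set.Ico 0 (2 * Real.pi), x = Real.cos θ ∧ y = Real.sin θ := by
  have hn : ‖(⟨x, y⟩ : ℂ)‖ = 1 := by
    rw [Complex.norm_def, Complex.normSq_mk, ← sq, ← sq, h, Real.sqrt_one]
  have hx := Complex.norm_mul_cos_arg ⟨x, y⟩
  have hy := Complex.norm_mul_sin_arg ⟨x, y⟩
  rw [hn, one_mul] at hx hy
  refine ⟨toIcoMod Real.two_pi_pos 0 (Complex.arg ⟨x, y⟩), ?_, ?_, ?_⟩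
  · simpa using toIcoMod_mem_Ico Real.two_pi_pos 0 (Complex.arg ⟨x, y⟩)
  · rw [toIcoMod, zsmul_eq_mul, Real.cos_sub_int_mul_two_pi, hx]
  · rw [toIcoMod, zsmul_eq_mul, Real.sin_sub_int_mul_two_pi, hy]

lemma paramReal_X {d : ℕ} (i : Fin d) : paramReal d (MvPolynomial.X i) = coord d i :=
  MvPolynomial.aeval_X _ _

theorem isVariety_trigMomentCurve {d : ℕ} (hd : Even d) (hpos : 0 < d) :
    IsVariety (trigMomentCurve d) := by
  refine ⟨ideal (trigMomentCurve d), Set.Subset.antisymm ?_ ?_⟩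
  · intro x hx p hp
    exact hp x hx
  intro x hx
  have hx : ∀ p, paramReal d p = 0 → MvPolynomial.eval x p = 0 :=
    fun p hp => hx p (mem_ideal_trigMomentCurve_iff.mpr hp)
  have h0 : 0 < d / 2 := by obtain ⟨m, rfl⟩ := hd; omega
  have hlt : ∀ k, k < d / 2 → d / 2 + k < d := by omega
  let c (k : ℕ) (hk : k < d / 2) : Fin d := ⟨k, by omega⟩
  let s (k : ℕ) (hk : k < d / 2) : Fin d := ⟨d / 2 + k, hlt k hk⟩
  have hc (k : ℕ) (hk : k < d / 2) :
      paramReal d (MvPolynomial.X (c k hk)) = cosL ((k : ℤ) + 1) := by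
    rw [paramReal_X, coord_cos hk]
  have hs (k : ℕ) (hk : k < d / 2) :
      paramReal d (MvPolynomial.X (s k hk)) = sinL ((k : ℤ) + 1) := by
    rw [paramReal_X, coord_sin]
  -- The circle relation is the addition formula for `cos (θ - θ)`; it yields the angle `θ`.
  have hcirc : x (c 0 h0) ^ 2 + x (s 0 h0) ^ 2 = 1 := by
    have := hx (MvPolynomial.X (c 0 h0) ^ 2 + MvPolynomial.X (s 0 h0) ^ 2 - 1) (by
      have h1 := cosL_add 1 (-1)
      rw [add_neg_cancel, cosL_zero, cosL_neg, sinL_neg] at h1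
      simp only [map_sub, map_add, map_pow, hc, hs, map_one, Nat.cast_zero, zero_add]
      linear_combination -h1)
    simpa [sub_eq_zero] using this
  obtain ⟨θ, hθ, hcos, hsin⟩ := exists_angle hcirc
  -- The addition formulas express each harmonic through the preceding one and the first, so `θ`
  -- determines all coordinates of `x`.
  have key (k : ℕ) (hk : k < d / 2) :
      x (c k hk) = Real.cos ((k + 1 : ℝ) * θ) ∧ x (s k hk) = Real.sin ((k + 1 : ℝ) * θ) := by
    induction k with
    | zero => simp [hcos, hsin]
    | succ k ih =>
      have hk' : k < d / 2 := by omega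
      obtain ⟨ih1, ih2⟩ := ih hk'
      have e1 := hx (MvPolynomial.X (c (k + 1) hk) -
        (MvPolynomial.X (c k hk') * MvPolynomial.X (c 0 h0) -
          MvPolynomial.X (s k hk') * MvPolynomial.X (s 0 h0))) (by
        simp only [map_sub, map_mul, hc, hs, Nat.cast_zero, zero_add, Nat.cast_succ]
        rw [cosL_add, sub_self])
      have e2 := hx (MvPolynomial.X (s (k + 1) hk) -
        (MvPolynomial.X (s k hk') * MvPolynomial.X (c 0 h0) +
          MvPolynomial.X (c k hk') * MvPolynomial.X (s 0 h0))) (by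
        simp only [map_sub, map_add, map_mul, hc, hs, Nat.cast_zero, zero_add, Nat.cast_succ]
        rw [sinL_add, sub_self])
      simp only [map_sub, map_add, map_mul, MvPolynomial.eval_X, sub_eq_zero] at e1 e2
      rw [e1, e2, ih1, ih2, hcos, hsin]
      push_cast
      rw [add_mul (k + 1 : ℝ) 1 θ, one_mul, Real.cos_add, Real.sin_add]
      exact ⟨rfl, rfl⟩
  refine ⟨θ, hθ, funext fun i => ?_⟩
  by_cases hi : (i : ℕ) < d / 2
  · exact (trigMoment_cos θ hi).trans (key i hi).1.symm
  · obtain ⟨k, hk⟩ : ∃ k, (i : ℕ) = d / 2 + k := ⟨i - d / 2, by omega⟩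
    have hk' : k < d / 2 := by obtain ⟨m, rfl⟩ := hd; omega
    obtain rfl : i = s k hk' := Fin.ext hk
    exact (trigMoment_sin θ _).trans (key k hk').2.symm

/-! ### Irreducible subvarieties and dimension. -/

lemma IsVariety.finite_of_ssubset_trigMomentCurve {d : ℕ} {W : Set (Fin d → ℝ)} (hW : IsVariety W)
    (h : W ⊂ trigMomentCurve d) : W.Finite := by
  obtain ⟨P, rfl⟩ := hW
  obtain ⟨x, hx, hxW⟩ := Set.exists_of_ssubset h
  rw [Set.mem_ofPred] at hxW
  push Not at hxW
  obtain ⟨p, hp, hpx⟩ := hxW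
  -- An equation of `W` that fails somewhere on the curve has only finitely many zeros there.
  have hp0 : paramReal d p ≠ 0 := fun h0 =>
    hpx (mem_ideal_trigMomentCurve_iff.mpr h0 x hx)
  refine ((finite_setOf_aeval_trigMoment_eq_zero hp0).image (trigMoment d)).subset ?_
  intro y hy
  obtain ⟨θ, hθ, rfl⟩ := h.1 hy
  exact ⟨θ, ⟨hθ, hy p hp⟩, rfl⟩

lemma trigMoment_injOn {d : ℕ} (hd : 1 < d) :
    Set.InjOn (trigMoment d) (Set.Ico 0 (2 * Real.pi)) := by
  intro θ hθ φ hφ h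
  refine expUnit_injOn hθ hφ (Units.ext ?_)
  have hcos := congrFun h ⟨0, by omega⟩
  have hsin := congrFun h ⟨d / 2 + 0, by omega⟩
  rw [trigMoment_cos _ (by omega), trigMoment_cos _ (by omega)] at hcos
  rw [trigMoment_sin, trigMoment_sin] at hsin
  simp only [Nat.cast_zero, zero_add, one_mul] at hcos hsin
  simp only [expUnit, Units.val_mk0, Complex.exp_mul_I, ← Complex.ofReal_cos,
    ← Complex.ofReal_sin, hcos, hsin]

lemma infinite_trigMomentCurve {d : ℕ} (hd : 1 < d) : (trigMomentCurve d).Infinite :=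
  infinite_Ico_zero_two_pi.image (trigMoment_injOn hd)

lemma isVariety_singleton {d : ℕ} (x : Fin d → ℝ) : IsVariety {x} := by
  refine ⟨Set.range fun i => MvPolynomial.X i - MvPolynomial.C (x i), ?_⟩
  ext y
  simp [sub_eq_zero, funext_iff]

lemma isIrreducibleVariety_singleton {d : ℕ} (x : Fin d → ℝ) : IsIrreducibleVariety {x} := by
  refine ⟨isVariety_singleton x, Set.singleton_nonempty x, fun A B _ _ h => ?_⟩
  rcases (h ▸ Set.mem_singleton x : x ∈ A ∪ B) with hx | hx
  · exact .inl (Set.Subset.antisymm (Set.singleton_subset_iff.mpr hx)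
      (h ▸ Set.subset_union_left))
  · exact .inr (Set.Subset.antisymm (Set.singleton_subset_iff.mpr hx)
      (h ▸ Set.subset_union_right))

lemma isVariety_of_finite {d : ℕ} {W : Set (Fin d → ℝ)} (hW : W.Finite) : IsVariety W := by
  induction W, hW using Set.Finite.induction_on with
  | empty => exact ⟨{1}, by ext; simp⟩
  | @insert a S _ _ ih =>
    obtain ⟨P, rfl⟩ := ih
    obtain ⟨Q, hQ⟩ := isVariety_singleton a
    refine ⟨{r | ∃ q ∈ Q, ∃ p ∈ P, r = q * p}, ?_⟩
    rw [Set.insert_eq, hQ]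
    ext x
    constructor
    · rintro (hx | hx) _ ⟨q, hq, p, hp, rfl⟩
      · rw [map_mul, hx q hq, zero_mul]
      · rw [map_mul, hx p hp, mul_zero]
    · intro hx
      by_contra! hc
      simp only [Set.mem_union, Set.mem_ofPred, not_or, not_forall] at hc
      obtain ⟨⟨q, hq, hqx⟩, ⟨p, hp, hpx⟩⟩ := hc
      have := hx _ ⟨q, hq, p, hp, rfl⟩
      rw [map_mul] at this
      exact (mul_ne_zero hqx hpx) this

/-- Removing one point leaves a finite set, again a variety, so a second point would make the set
reducible. -/
lemma IsIrreducibleVariety.eq_singleton_of_finite {d : ℕ} {W : Set (Fin d → ℝ)}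
    (hW : IsIrreducibleVariety W) (hfin : W.Finite) : ∃ x, W = {x} := by
  obtain ⟨-, ⟨x, hx⟩, hirr⟩ := hW
  refine ⟨x, ?_⟩
  rcases hirr {x} (W \ {x}) (isVariety_singleton x) (isVariety_of_finite hfin.sdiff)
    (by rw [Set.union_sdiff_self, Set.union_eq_self_of_subset_left (by simpa using hx)]) with h | h
  · exact h
  · rw [h] at hx
    exact absurd rfl hx.2

lemma isIrreducibleVariety_trigMomentCurve {d : ℕ} (hd : Even d) (hpos : 0 < d) :
    IsIrreducibleVariety (trigMomentCurve d) := by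
  have hd1 : 1 < d := by obtain ⟨m, rfl⟩ := hd; omega
  refine ⟨isVariety_trigMomentCurve hd hpos, (infinite_trigMomentCurve hd1).nonempty, ?_⟩
  intro A B hA hB h
  by_contra! hc
  have hAs : A ⊂ trigMomentCurve d := (h ▸ Set.subset_union_left).ssubset_of_ne hc.1.symm
  have hBs : B ⊂ trigMomentCurve d := (h ▸ Set.subset_union_right).ssubset_of_ne hc.2.symm
  refine infinite_trigMomentCurve hd1 ?_
  rw [h]
  exact (hA.finite_of_ssubset_trigMomentCurve hAs).union
    (hB.finite_of_ssubset_trigMomentCurve hBs)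

theorem dim_trigMomentCurve {d : ℕ} (hd : Even d) (hpos : 0 < d) :
    dim (trigMomentCurve d) = 1 := by
  have hd1 : 1 < d := by obtain ⟨m, rfl⟩ := hd; omega
  apply le_antisymm
  -- Dimension at most one means that every element of the order is minimal or maximal: the curve
  -- itself is maximal, and all other irreducible subvarieties are points, hence minimal.
  · refine Order.krullDim_le_one_iff.mpr ?_
    rintro ⟨W, hW, hWM⟩
    rcases hWM.eq_or_ssubset with rfl | hs
    · exact .inr fun V _ => V.2.2
    · left
      obtain ⟨x, rfl⟩ := hW.eq_singleton_of_finite (hW.1.finite_of_ssubset_trigMomentCurve hs)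
      rintro ⟨V, hV, hVM⟩ hle
      have hle : V ⊆ {x} := hle
      exact (((Set.subset_singleton_iff_eq.mp hle).resolve_left hV.2.1.ne_empty).symm).le
  · refine Order.one_le_krullDim_iff.mpr ?_
    obtain ⟨x, hx⟩ := (infinite_trigMomentCurve hd1).nonempty
    have hx' : ({x} : Set (Fin d → ℝ)) ⊆ trigMomentCurve d := Set.singleton_subset_iff.mpr hx
    refine ⟨⟨{x}, isIrreducibleVariety_singleton x, hx'⟩,
      ⟨trigMomentCurve d, isIrreducibleVariety_trigMomentCurve hd hpos, subset_rfl⟩, ?_⟩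
    refine hx'.ssubset_of_ne fun h => infinite_trigMomentCurve hd1 ?_
    rw [← h]
    exact Set.finite_singleton x

/-! ### Trigonometric polynomials and the Hilbert function. -/

/-- The trigonometric basis of the real Laurent polynomials: `cos (k θ)` for `0 ≤ k` and
`sin (k θ)` for `k < 0`. -/
def trigBasis (k : ℤ) : LaurentPolynomial ℂ := if 0 ≤ k then cosL k else sinL k

/-- The real trigonometric polynomials of degree at most `N`. -/
def trigSpan (N : ℕ) : Submodule ℝ (LaurentPolynomial ℂ) :=
  Submodule.span ℝ (trigBasis '' Set.Icc (-N : ℤ) N)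

/-- The `k`-th coefficient as a real linear map. -/
def coeffReal (k : ℤ) : LaurentPolynomial ℂ →ₗ[ℝ] ℂ where
  toFun f := f.coeff k
  map_add' _ _ := rfl
  map_smul' _ _ := rfl

/-- A family of functionals dual to `trigBasis`. -/
def trigDual (k : ℤ) : LaurentPolynomial ℂ →ₗ[ℝ] ℝ :=
  -- Cosines have real coefficients and sines imaginary ones, so `re` and `im` separate them. The
  -- factors normalize the coefficient at `T ^ k`: `-i / 2` for a sine, `1 / 2` for a cosine with `k
  -- > 0`, and `1` for `k = 0`.
  if k < 0 then (-2 : ℝ) • Complex.imLm ∘ₗ coeffReal k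
  else (if k = 0 then (1 : ℝ) else 2) • Complex.reLm ∘ₗ coeffReal k

lemma coeff_cosL (j k : ℤ) :
    (cosL j).coeff k = 1 / 2 * ((if j = k then 1 else 0) + if -j = k then 1 else 0) := by
  change (1 / 2 : ℂ) • ((T j : LaurentPolynomial ℂ).coeff k + (T (-j)).coeff k) = _
  rw [LaurentPolynomial.T_apply, LaurentPolynomial.T_apply, smul_eq_mul]

lemma coeff_sinL (j k : ℤ) :
    (sinL j).coeff k =
      -Complex.I / 2 * ((if j = k then 1 else 0) - if -j = k then 1 else 0) := by
  change (-Complex.I / 2 : ℂ) • ((T j : LaurentPolynomial ℂ).coeff k - (T (-j)).coeff k) = _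
  rw [LaurentPolynomial.T_apply, LaurentPolynomial.T_apply, smul_eq_mul]

lemma trigDual_trigBasis (k j : ℤ) : trigDual k (trigBasis j) = if j = k then 1 else 0 := by
  have h1 : coeffReal k (cosL j) =
    1 / 2 * ((if j = k then 1 else 0) + if -j = k then 1 else 0) := coeff_cosL j k
  have h2 : coeffReal k (sinL j) =
    -Complex.I / 2 * ((if j = k then 1 else 0) - if -j = k then 1 else 0) := coeff_sinL j k
  unfold trigDual trigBasis
  split_ifs <;> simp [h1, h2] <;> split_ifs <;> first | omega | norm_num

lemma linearIndependent_trigBasis : LinearIndependent ℝ trigBasis :=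
  .of_pairwise_dual_eq_zero_one _ trigDual
    (fun i j hij => (trigDual_trigBasis i j).trans (if_neg hij.symm))
    (fun i => (trigDual_trigBasis i i).trans (if_pos rfl))

lemma finrank_trigSpan (N : ℕ) : Module.finrank ℝ (trigSpan N) = 2 * N + 1 := by
  have h := finrank_span_eq_card
    (linearIndependent_trigBasis.comp (Subtype.val : Set.Icc (-N : ℤ) N → ℤ)
      Subtype.val_injective)
  rw [Set.range_comp, Subtype.range_coe] at h
  rw [trigSpan, h, Fintype.card_ofFinset, Int.card_Icc]
  omega

lemma cosL_mem_trigSpan {N : ℕ} {k : ℤ} (hk : |k| ≤ N) : cosL k ∈ trigSpan N := by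
  have h : cosL k = trigBasis |k| := by
    rw [trigBasis, if_pos (abs_nonneg k)]
    rcases abs_choice k with h | h <;> rw [h]
    rw [cosL_neg]
  rw [h]
  exact Submodule.subset_span ⟨_, ⟨by have := abs_nonneg k; omega, hk⟩, rfl⟩

lemma sinL_mem_trigSpan {N : ℕ} {k : ℤ} (hk : |k| ≤ N) : sinL k ∈ trigSpan N := by
  rw [abs_le] at hk
  rcases lt_trichotomy k 0 with h | rfl | h
  · refine Submodule.subset_span ⟨k, hk, ?_⟩
    rw [trigBasis, if_neg (by omega)]
  · rw [sinL_zero]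
    exact zero_mem _
  · rw [← neg_neg k, sinL_neg]
    refine neg_mem (Submodule.subset_span ⟨-k, ⟨by omega, by omega⟩, ?_⟩)
    rw [trigBasis, if_neg (by omega)]

/-- These are the product-to-sum formulas: the addition formulas for `j + k` and `j - k`, added or
subtracted, give twice each product of basis elements. -/
lemma mul_mem_trigSpan {M N : ℕ} {f g : LaurentPolynomial ℂ} (hf : f ∈ trigSpan M)
    (hg : g ∈ trigSpan N) : f * g ∈ trigSpan (M + N) := by
  have key : trigSpan M * trigSpan N ≤ trigSpan (M + N) := by
    rw [trigSpan, trigSpan, Submodule.span_mul_span, Submodule.span_le]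
    rintro _ ⟨_, ⟨j, hj, rfl⟩, _, ⟨k, hk, rfl⟩, rfl⟩
    have hadd : |j + k| ≤ ((M + N : ℕ) : ℤ) := by
      rw [abs_le]; push_cast; exact ⟨by linarith [hj.1, hk.1], by linarith [hj.2, hk.2]⟩
    have hsub : |j + -k| ≤ ((M + N : ℕ) : ℤ) := by
      rw [abs_le]; push_cast; exact ⟨by linarith [hj.1, hk.2], by linarith [hj.2, hk.1]⟩
    have half : ∀ x : LaurentPolynomial ℂ, x + x ∈ trigSpan (M + N) → x ∈ trigSpan (M + N) := by
      intro x hx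
      have := Submodule.smul_mem _ (1 / 2 : ℝ) hx
      rw [← two_smul ℝ, smul_smul] at this
      norm_num at this
      exact this
    have c1 := cosL_mem_trigSpan hadd
    have c2 := cosL_mem_trigSpan hsub
    have s1 := sinL_mem_trigSpan hadd
    have s2 := sinL_mem_trigSpan hsub
    rw [cosL_add] at c1 c2
    rw [sinL_add] at s1 s2
    rw [cosL_neg, sinL_neg] at c2 s2
    apply half
    simp only [trigBasis]
    split_ifs
    · convert! add_mem c1 c2 using 1; ring
    · convert! sub_mem s1 s2 using 1; ring
    · convert! add_mem s1 s2 using 1; ring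
    · convert! sub_mem c2 c1 using 1; ring
  exact key (Submodule.mul_mem_mul hf hg)

lemma one_mem_trigSpan (N : ℕ) : (1 : LaurentPolynomial ℂ) ∈ trigSpan N := by
  rw [← cosL_zero]
  exact cosL_mem_trigSpan (by simp)

lemma trigSpan_mono : Monotone trigSpan := fun M N h =>
  Submodule.span_mono (Set.image_mono (Set.Icc_subset_Icc (by omega) (by omega)))

lemma coord_mem_trigSpan {d : ℕ} (hd : Even d) (i : Fin d) : coord d i ∈ trigSpan (d / 2) := by
  have := i.2
  obtain ⟨m, rfl⟩ := hd
  rw [coord]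
  split_ifs
  · exact cosL_mem_trigSpan (by rw [abs_le]; omega)
  · exact sinL_mem_trigSpan (by rw [abs_le]; omega)

lemma paramReal_monomial_mem_trigSpan {d : ℕ} (hd : Even d) (s : Fin d →₀ ℕ) :
    paramReal d (MvPolynomial.monomial s 1) ∈ trigSpan (s.degree * (d / 2)) := by
  induction s using Finsupp.induction_linear with
  | zero =>
    rw [MvPolynomial.monomial_zero', map_one, map_one]
    exact one_mem_trigSpan _
  | add s t hs ht =>
    rw [← one_mul (1 : ℝ), ← MvPolynomial.monomial_mul, map_mul, map_add, add_mul]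
    exact mul_mem_trigSpan hs ht
  | single i n =>
    rw [← MvPolynomial.X_pow_eq_monomial, map_pow, paramReal_X, Finsupp.degree_single]
    induction n with
    | zero => rw [pow_zero]; exact one_mem_trigSpan _
    | succ n ih =>
      rw [pow_succ, add_mul, one_mul]
      exact mul_mem_trigSpan ih (coord_mem_trigSpan hd i)

lemma paramReal_mem_trigSpan {d n : ℕ} (hd : Even d) {p : MvPolynomial (Fin d) ℝ}
    (hp : p.totalDegree ≤ n) : paramReal d p ∈ trigSpan (n * (d / 2)) := by
  rw [p.as_sum, map_sum]
  refine sum_mem fun s hs => ?_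
  rw [← mul_one (p.coeff s), ← smul_eq_mul (p.coeff s), ← MvPolynomial.smul_monomial, map_smul]
  refine Submodule.smul_mem _ _ (trigSpan_mono ?_ (paramReal_monomial_mem_trigSpan hd s))
  exact Nat.mul_le_mul_right _ ((MvPolynomial.le_totalDegree hs).trans hp)

/-- The image of the polynomials of degree at most `n` under `paramReal`. -/
def paramImage (d n : ℕ) : Submodule ℝ (LaurentPolynomial ℂ) :=
  (MvPolynomial.restrictTotalDegree (Fin d) ℝ n).map (paramReal d).toLinearMap

lemma mul_mem_paramImage {d m n : ℕ} {f g : LaurentPolynomial ℂ} (hf : f ∈ paramImage d m)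
    (hg : g ∈ paramImage d n) : f * g ∈ paramImage d (m + n) := by
  obtain ⟨p, hp, rfl⟩ := hf
  obtain ⟨q, hq, rfl⟩ := hg
  rw [SetLike.mem_coe, MvPolynomial.mem_restrictTotalDegree] at hp hq
  refine ⟨p * q, ?_, map_mul (paramReal d) p q⟩
  rw [SetLike.mem_coe, MvPolynomial.mem_restrictTotalDegree]
  exact (MvPolynomial.totalDegree_mul p q).trans (Nat.add_le_add hp hq)

lemma one_mem_paramImage (d n : ℕ) : 1 ∈ paramImage d n :=
  ⟨1, by simp [MvPolynomial.mem_restrictTotalDegree], map_one (paramReal d)⟩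

lemma coord_mem_paramImage {d : ℕ} (i : Fin d) : coord d i ∈ paramImage d 1 :=
  ⟨MvPolynomial.X i, by simp [MvPolynomial.mem_restrictTotalDegree], paramReal_X i⟩

lemma cosL_sinL_mem_paramImage_one {d k : ℕ} (hk : k ≤ d / 2) :
    cosL k ∈ paramImage d 1 ∧ sinL k ∈ paramImage d 1 := by
  cases k with
  | zero =>
    rw [Nat.cast_zero, cosL_zero, sinL_zero]
    exact ⟨one_mem_paramImage d 1, zero_mem _⟩
  | succ k =>
    rw [Nat.cast_succ, ← coord_cos hk, ← coord_sin (d := d) (by omega)]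
    exact ⟨coord_mem_paramImage _, coord_mem_paramImage _⟩

/-- One more degree extends the reachable frequencies by `d / 2`: a frequency is split as `a + b`
with `b ≤ d / 2`, and the addition formulas are bilinear in the harmonics `a` and `b`. -/
lemma cosL_sinL_mem_paramImage {d n k : ℕ} (hk : k ≤ n * (d / 2)) :
    cosL k ∈ paramImage d n ∧ sinL k ∈ paramImage d n := by
  induction n generalizing k with
  | zero =>
    obtain rfl : k = 0 := by omega
    rw [Nat.cast_zero, cosL_zero, sinL_zero]
    exact ⟨one_mem_paramImage d 0, zero_mem _⟩
  | succ n ih =>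
    obtain ⟨a, b, ha, hb, rfl⟩ : ∃ a b, a ≤ n * (d / 2) ∧ b ≤ d / 2 ∧ k = a + b := by
      rw [add_mul, one_mul] at hk
      exact ⟨min k (n * (d / 2)), k - min k (n * (d / 2)), by omega, by omega, by omega⟩
    obtain ⟨ca, sa⟩ := ih ha
    obtain ⟨cb, sb⟩ := cosL_sinL_mem_paramImage_one hb
    rw [Nat.cast_add, cosL_add, sinL_add]
    exact ⟨sub_mem (mul_mem_paramImage ca cb) (mul_mem_paramImage sa sb),
      add_mem (mul_mem_paramImage sa cb) (mul_mem_paramImage ca sb)⟩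

lemma paramImage_eq_trigSpan {d : ℕ} (hd : Even d) (n : ℕ) :
    paramImage d n = trigSpan (n * (d / 2)) := by
  apply le_antisymm
  · rintro _ ⟨p, hp, rfl⟩
    exact paramReal_mem_trigSpan hd ((MvPolynomial.mem_restrictTotalDegree _ _ _).mp hp)
  · refine Submodule.span_le.mpr ?_
    rintro _ ⟨k, hk, rfl⟩
    rw [trigBasis, SetLike.mem_coe]
    obtain ⟨j, rfl | rfl⟩ := k.eq_nat_or_neg
    · have := cosL_sinL_mem_paramImage (d := d) (n := n) (k := j) (by have := hk.2; omega)
      rw [if_pos (by omega)]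
      exact this.1
    · have := cosL_sinL_mem_paramImage (d := d) (n := n) (k := j) (by have := hk.1; omega)
      rw [cosL_neg, sinL_neg]
      split_ifs
      · exact this.1
      · exact neg_mem this.2

theorem hilbertFunction_trigMomentCurve {d : ℕ} (hd : Even d) (n : ℕ) :
    hilbertFunction (trigMomentCurve d) n = n * d + 1 := by
  let R := MvPolynomial.restrictTotalDegree (Fin d) ℝ n
  let f := (paramReal d).toLinearMap.domRestrict R
  have hker : ((ideal (trigMomentCurve d)).restrictScalars ℝ).submoduleOf R =
      LinearMap.ker f := by
    ext p
    exact mem_ideal_trigMomentCurve_iff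
  have hrange : LinearMap.range f = trigSpan (n * (d / 2)) := by
    rw [← paramImage_eq_trigSpan hd, paramImage, LinearMap.range_domRestrict]
  rw [hilbertFunction, hker, f.quotKerEquivRange.finrank_eq, hrange, finrank_trigSpan]
  obtain ⟨m, rfl⟩ := hd
  rw [← two_mul, Nat.mul_div_cancel_left _ two_pos]
  ring

/-! ### Intersection multiplicities as root multiplicities. -/

/-- The length of a local ring `𝒪 / J 𝒪` can be computed after a surjective ring homomorphism whose
kernel is contained in `J`. -/
lemma length_localization_quotient_map_of_surjective {R S : Type*} [CommRing R] [CommRing S]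
    {φ : R →+* S} (hφ : Function.Surjective φ) (p : Ideal S) [p.IsPrime] (q : Ideal R) [q.IsPrime]
    (hq : q = p.comap φ) {J : Ideal R} (hJ : RingHom.ker φ ≤ J) :
    Module.length (Localization.AtPrime q)
        (Localization.AtPrime q ⧸ J.map (algebraMap R (Localization.AtPrime q))) =
      Module.length (Localization.AtPrime p)
        (Localization.AtPrime p ⧸ (J.map φ).map (algebraMap S (Localization.AtPrime p))) := by
  let g := Localization.localRingHom q p φ hq
  have hg : Function.Surjective g :=
    (RingHom.surjectiveOnStalks_of_surjective hφ).localRingHom_surjective q p hq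
  -- Since `φ` maps the complement of `q` onto that of `p`, the kernel of the local map is the
  -- extension of `ker φ`.
  have hkg : RingHom.ker g ≤ J.map (algebraMap R (Localization.AtPrime q)) := by
    have hT : Submonoid.map φ q.primeCompl = p.primeCompl := by
      ext x
      constructor
      · rintro ⟨y, hy, rfl⟩
        exact fun h => hy (hq ▸ h)
      · intro hx
        obtain ⟨y, rfl⟩ := hφ x
        exact ⟨y, fun h => hx (by rw [hq] at h; exact h), rfl⟩
    exact (IsLocalization.ker_map (S := Localization.AtPrime q)
      (Q := Localization.AtPrime p) φ hT).trans_le (Ideal.map_mono hJ)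
  have hmap : (J.map φ).map (algebraMap S (Localization.AtPrime p)) =
      (J.map (algebraMap R (Localization.AtPrime q))).map g := by
    rw [Ideal.map_map, Ideal.map_map]
    congr 1
    ext x
    exact (Localization.localRingHom_to_map q p φ hq x).symm
  let := g.toAlgebra
  let I := (J.map φ).map (algebraMap S (Localization.AtPrime p))
  let f : Localization.AtPrime q →ₗ[Localization.AtPrime q] Localization.AtPrime p ⧸ I :=
    (I.mkQ.restrictScalars (Localization.AtPrime q)).comp
      (Algebra.linearMap (Localization.AtPrime q) (Localization.AtPrime p))
  have hf : Function.Surjective f := (Submodule.mkQ_surjective I).comp hg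
  have hker : J.map (algebraMap R (Localization.AtPrime q)) = LinearMap.ker f := by
    ext x
    have h1 : x ∈ LinearMap.ker f ↔ g x ∈ I := Submodule.Quotient.mk_eq_zero I
    have h2 := Ideal.comap_map_of_surjective g hg (J.map (algebraMap R (Localization.AtPrime q)))
    rw [← hmap, ← RingHom.ker_eq_comap_bot, sup_of_le_left hkg] at h2
    rw [h1, ← h2, Ideal.mem_comap]
  -- The two quotients are isomorphic over the local ring at `q`, and along the surjection `g`
  -- length does not depend on which ring acts.
  have e := (Submodule.quotEquivOfEq _ _ hker).trans (f.quotKerEquivOfSurjective hf)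
  rw [e.length_eq]
  exact Module.length_eq_of_surjective hg

instance isPrime_ker_evalAt (t : ℂˣ) : (RingHom.ker (evalAt t)).IsPrime :=
  RingHom.ker_isPrime _

lemma isUnit_algebraMap_atPrime_ker {t : ℂˣ} {f : LaurentPolynomial ℂ} (hf : evalAt t f ≠ 0) :
    IsUnit (algebraMap _ (Localization.AtPrime (RingHom.ker (evalAt t))) f) :=
  (IsLocalization.AtPrime.isUnit_to_map_iff _ (RingHom.ker (evalAt t)) f).mpr hf

/-- Up to the unit `T ^ n` a Laurent polynomial is a polynomial, to which the factor theorem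
applies. -/
lemma ker_evalAt (t : ℂˣ) :
    RingHom.ker (evalAt t) =
      Ideal.span {Polynomial.toLaurent (Polynomial.X - Polynomial.C (t : ℂ))} := by
  apply le_antisymm
  · intro f hf
    obtain ⟨n, p, hp⟩ := f.exists_T_pow
    have hp0 : p.eval (t : ℂ) = 0 := by
      rw [← evalAt_toLaurent, hp, map_mul, RingHom.mem_ker.mp hf, zero_mul]
    obtain ⟨q, rfl⟩ := Polynomial.dvd_iff_isRoot.mpr hp0
    rw [Ideal.mem_span_singleton, ← (LaurentPolynomial.isUnit_T (n : ℤ)).dvd_mul_right, ← hp,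
      map_mul]
    exact dvd_mul_right _ _
  · rw [Ideal.span_singleton_le_iff_mem, RingHom.mem_ker, evalAt_toLaurent]
    simp

lemma ord_atPrime_X_sub_C (t : ℂˣ) :
    Ring.ord (Localization.AtPrime (RingHom.ker (evalAt t)))
      (algebraMap _ _ (Polynomial.toLaurent (Polynomial.X - Polynomial.C (t : ℂ)))) = 1 := by
  -- By `ker_evalAt`, `X - t` generates the maximal ideal, so the quotient is the residue field, of
  -- length one.
  rw [Ring.ord, Module.length_eq_one_iff, ← Set.image_singleton, ← Ideal.map_span, ← ker_evalAt,
    Localization.AtPrime.map_eq_maximalIdeal, isSimpleModule_iff_isCoatom, ← Ideal.isMaximal_def]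
  infer_instance

/-- The order of vanishing at `t` of a product of linear factors. -/
lemma ord_atPrime_prod_X_sub_C (t : ℂˣ) (s : Multiset ℂ) :
    Ring.ord (Localization.AtPrime (RingHom.ker (evalAt t)))
      (algebraMap _ _ (Polynomial.toLaurent
        (s.map fun a => Polynomial.X - Polynomial.C a).prod)) = s.count (t : ℂ) := by
  classical
  induction s using Multiset.induction_on with
  | empty => simp
  | cons a s ih =>
    have hne : algebraMap _ (Localization.AtPrime (RingHom.ker (evalAt t)))
        (Polynomial.toLaurent (Polynomial.X - Polynomial.C a)) ≠ 0 := by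
      rw [Ne, FaithfulSMul.algebraMap_eq_zero_iff, Polynomial.toLaurent_eq_zero]
      exact Polynomial.X_sub_C_ne_zero a
    rw [Multiset.map_cons, Multiset.prod_cons, map_mul, map_mul,
      Ring.ord_mul' _ (mem_nonZeroDivisors_of_ne_zero hne), ih]
    by_cases h : (t : ℂ) = a
    · subst h
      rw [ord_atPrime_X_sub_C, Multiset.count_cons_self, Nat.cast_add, Nat.cast_one, add_comm]
    · rw [Ring.ord_of_isUnit (isUnit_algebraMap_atPrime_ker ?_), zero_add,
        Multiset.count_cons_of_ne h]
      rw [evalAt_toLaurent]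
      simpa [sub_eq_zero] using h

lemma ord_atPrime_toLaurent (t : ℂˣ) {p : Polynomial ℂ} (hp : p ≠ 0) :
    Ring.ord (Localization.AtPrime (RingHom.ker (evalAt t)))
      (algebraMap _ _ (Polynomial.toLaurent p)) = p.roots.count (t : ℂ) := by
  conv_lhs => rw [(IsAlgClosed.splits p).eq_prod_roots]
  rw [map_mul, map_mul, Ring.ord_mul_of_isUnit_left, ord_atPrime_prod_X_sub_C]
  refine isUnit_algebraMap_atPrime_ker ?_
  rw [evalAt_toLaurent]
  simpa using hp

lemma point_injective {d : ℕ} (hd : 1 < d) : Function.Injective (point d) := by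
  intro t u h
  obtain ⟨p, hp⟩ := param_surjective hd (T 1)
  have ht := evalAt_param d t p
  have hu := evalAt_param d u p
  rw [hp, evalAt_T, zpow_one] at ht hu
  exact Units.ext (by rw [ht, hu, h])

/-- The image of `T` is invertible and determines the homomorphism, so the points of the
complexified curve are the elements of `ℂˣ`. -/
lemma exists_eq_evalAt (g : LaurentPolynomial ℂ →ₐ[ℂ] ℂ) : ∃ t : ℂˣ, g = evalAt t := by
  have h : g (T 1) * g (T (-1)) = 1 := by
    rw [← map_mul, ← LaurentPolynomial.T_add, add_neg_cancel, LaurentPolynomial.T_zero, map_one]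
  refine ⟨Units.mkOfMulEqOne _ _ h, ?_⟩
  refine AlgHom.ext fun f => ?_
  induction f using LaurentPolynomial.induction_on' with
  | add p q hp hq => rw [map_add, map_add, hp, hq]
  | C_mul_T n a =>
    rw [← LaurentPolynomial.smul_eq_C_mul, map_smul, map_smul, evalAt_T]
    congr 1
    obtain ⟨n, rfl | rfl⟩ := n.eq_nat_or_neg
    · have := LaurentPolynomial.T_pow (R := ℂ) 1 n
      rw [mul_one] at this
      rw [← this, map_pow]
      simp
    · have := LaurentPolynomial.T_pow (R := ℂ) (-1) n
      rw [mul_neg_one] at this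
      rw [← this, map_pow, zpow_neg, ← inv_zpow]
      simp [eq_inv_of_mul_eq_one_right h]

lemma zeroLocus_eq_image_point {d : ℕ} (hd : 1 < d) {J : Ideal (MvPolynomial (Fin d) ℂ)}
    (hJ : RingHom.ker (param d) ≤ J) {l : LaurentPolynomial ℂ}
    (hl : J.map (param d) = Ideal.span {l}) :
    MvPolynomial.zeroLocus ℂ J = point d '' {t | evalAt t l = 0} := by
  have hs := param_surjective hd
  ext z
  constructor
  · intro hz
    -- Evaluation at `z` kills the kernel of `param`, so it factors through the Laurent ring and is
    -- evaluation at some `t`.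
    let g := AlgHom.liftOfSurjective (param d) hs (MvPolynomial.aeval z)
      (fun p hp => hz p (hJ hp))
    have hg : ∀ p, g (param d p) = MvPolynomial.aeval z p :=
      AlgHom.liftOfSurjective_apply _ _ _ _
    obtain ⟨t, ht⟩ := exists_eq_evalAt g
    refine ⟨t, ?_, ?_⟩
    · have h1 : l ∈ J.map (param d) := hl ▸ Ideal.mem_span_singleton_self l
      obtain ⟨p, hp, rfl⟩ := (Ideal.mem_map_iff_of_surjective _ hs).mp h1
      rw [Set.mem_ofPred, ← ht, hg]
      exact hz p hp
    · funext i
      have := hg (MvPolynomial.X i)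
      rw [ht, evalAt_param, MvPolynomial.aeval_X, MvPolynomial.aeval_X] at this
      exact this
  · rintro ⟨t, ht, rfl⟩ p hp
    have ht : evalAt t l = 0 := ht
    have h1 : param d p ∈ Ideal.span {l} := hl ▸ Ideal.mem_map_of_mem _ hp
    obtain ⟨q, hq⟩ := Ideal.mem_span_singleton.mp h1
    rw [← evalAt_param, hq, map_mul, ht, zero_mul]

lemma localMultiplicity_point {d : ℕ} (hd : 1 < d) {J : Ideal (MvPolynomial (Fin d) ℂ)}
    (hJ : RingHom.ker (param d) ≤ J) {l : LaurentPolynomial ℂ}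
    (hl : J.map (param d) = Ideal.span {l}) (t : ℂˣ) :
    localMultiplicity J (point d t) =
      Ring.ord (Localization.AtPrime (RingHom.ker (evalAt t))) (algebraMap _ _ l) := by
  have hq : (MvPolynomial.vanishingIdeal ℂ {point d t} : Ideal (MvPolynomial (Fin d) ℂ)) =
      (RingHom.ker (evalAt t)).comap
        (param d : MvPolynomial (Fin d) ℂ →+* LaurentPolynomial ℂ) := by
    ext p
    rw [MvPolynomial.mem_vanishingIdeal_singleton_iff, ← evalAt_param]
    rfl
  have hJ' : RingHom.ker (param d : MvPolynomial (Fin d) ℂ →+* LaurentPolynomial ℂ) ≤ J := hJ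
  have hl' : J.map (param d : MvPolynomial (Fin d) ℂ →+* LaurentPolynomial ℂ) =
    Ideal.span {l} := hl
  have key := length_localization_quotient_map_of_surjective
    (φ := (param d : MvPolynomial (Fin d) ℂ →+* LaurentPolynomial ℂ)) (param_surjective hd)
    (RingHom.ker (evalAt t)) _ hq hJ'
  rw [hl', Ideal.map_span, Set.image_singleton] at key
  exact key

/-- The intersection multiplicities of the complexified curve with a hypersurface whose equation
restricts to `T ^ (-m) f(T)`, where `f(0) ≠ 0`, add up to the degree of `f`. -/
lemma finsum_localMultiplicity {d : ℕ} (hd : 1 < d) {J : Ideal (MvPolynomial (Fin d) ℂ)}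
    (hJ : RingHom.ker (param d) ≤ J) {l : LaurentPolynomial ℂ}
    (hl : J.map (param d) = Ideal.span {l}) {f : Polynomial ℂ} {m : ℤ}
    (hf : Polynomial.toLaurent f = T m * l) (hf0 : f.coeff 0 ≠ 0) :
    (MvPolynomial.zeroLocus ℂ J).Finite ∧
      ∑ᶠ z ∈ MvPolynomial.zeroLocus ℂ J, localMultiplicity J z = f.natDegree := by
  classical
  have hne : f ≠ 0 := by rintro rfl; simp at hf0
  have hmult : ∀ t, localMultiplicity J (point d t) = f.roots.count (t : ℂ) := by
    intro t
    rw [localMultiplicity_point hd hJ hl, ← ord_atPrime_toLaurent t hne, hf, map_mul,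
      Ring.ord_mul_of_isUnit_left ((LaurentPolynomial.isUnit_T m).map _)]
  have hzero : Units.val '' {t | evalAt t l = 0} = (f.roots.toFinset : Set ℂ) := by
    have heval : ∀ t : ℂˣ, evalAt t l = 0 ↔ f.eval (t : ℂ) = 0 := by
      intro t
      rw [← evalAt_toLaurent, hf, map_mul, evalAt_T, mul_eq_zero,
        or_iff_right (Units.ne_zero _)]
    ext a
    rw [Finset.mem_coe, Multiset.mem_toFinset, Polynomial.mem_roots hne, Polynomial.IsRoot.def]
    constructor
    · rintro ⟨t, ht, rfl⟩
      exact (heval t).mp ht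
    · intro ha
      -- Here `f(0) ≠ 0` matters: no root of `f` is lost when passing to `ℂˣ`.
      have ha0 : a ≠ 0 := by
        rintro rfl
        exact hf0 (by rwa [Polynomial.coeff_zero_eq_eval_zero])
      exact ⟨Units.mk0 a ha0, (heval _).mpr ha, rfl⟩
  rw [zeroLocus_eq_image_point hd hJ hl]
  constructor
  · refine Set.Finite.image _ (Set.Finite.of_finite_image (f := Units.val) ?_
      Units.val_injective.injOn)
    rw [hzero]
    exact Finset.finite_toSet _
  · rw [finsum_mem_image (point_injective hd).injOn]
    simp only [hmult]
    rw [← finsum_mem_image (f := fun a : ℂ => (f.roots.count a : ℕ∞)) Units.val_injective.injOn,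
      hzero, finsum_mem_coe_finset, ← Nat.cast_sum, Multiset.toFinset_sum_count_eq,
      ← (IsAlgClosed.splits f).natDegree_eq_card_roots]

/-! ### Hyperplane sections and the degree. -/

/-- The polynomial `T ^ (d / 2) * coord d i`. -/
def coordPoly (d : ℕ) (i : Fin d) : Polynomial ℂ :=
  if (i : ℕ) < d / 2 then
    Polynomial.C (1 / 2) * (Polynomial.X ^ (d / 2 + (i + 1)) + Polynomial.X ^ (d / 2 - (i + 1)))
  else
    Polynomial.C (-Complex.I / 2) *
      (Polynomial.X ^ (d / 2 + (i - d / 2 + 1)) - Polynomial.X ^ (d / 2 - (i - d / 2 + 1)))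

lemma toLaurent_coordPoly {d : ℕ} (hd : Even d) (i : Fin d) :
    Polynomial.toLaurent (coordPoly d i) = T (d / 2 : ℕ) * coord d i := by
  have hi := i.2
  have h2 : d / 2 + d / 2 = d := by obtain ⟨m, rfl⟩ := hd; omega
  have key : ∀ k : ℕ, k ≤ d / 2 → (T ((d / 2 + k : ℕ) : ℤ) : LaurentPolynomial ℂ) =
      T (d / 2 : ℕ) * T k ∧ (T ((d / 2 - k : ℕ) : ℤ) : LaurentPolynomial ℂ) =
      T (d / 2 : ℕ) * T (-k) := by
    intro k hk
    rw [← LaurentPolynomial.T_add, ← LaurentPolynomial.T_add, Nat.cast_add, Nat.cast_sub hk]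
    exact ⟨rfl, rfl⟩
  rw [coordPoly, coord]
  split_ifs with h
  · obtain ⟨h1, h2⟩ := key (i + 1) (by omega)
    rw [map_mul, map_add, Polynomial.toLaurent_C, Polynomial.toLaurent_X_pow,
      Polynomial.toLaurent_X_pow, h1, h2, cosL_eq]
    push_cast
    ring
  · obtain ⟨h1, h2⟩ := key (i - d / 2 + 1) (by omega)
    rw [map_mul, map_sub, Polynomial.toLaurent_C, Polynomial.toLaurent_X_pow,
      Polynomial.toLaurent_X_pow, h1, h2, sinL_eq, Nat.cast_succ]
    ring

/-- The polynomial `T ^ (d / 2) * param d (affineForm a b)`. -/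
def sectionPoly {d : ℕ} (a : Fin d → ℂ) (b : ℂ) : Polynomial ℂ :=
  ∑ i, Polynomial.C (a i) * coordPoly d i - Polynomial.C b * Polynomial.X ^ (d / 2)

lemma toLaurent_sectionPoly {d : ℕ} (hd : Even d) (a : Fin d → ℂ) (b : ℂ) :
    Polynomial.toLaurent (sectionPoly a b) = T (d / 2 : ℕ) * param d (affineForm a b) := by
  have hC : ∀ r, param d (MvPolynomial.C r) = LaurentPolynomial.C r := fun r =>
    MvPolynomial.aeval_C _ _
  have hX : ∀ i, param d (MvPolynomial.X i) = coord d i := fun i => MvPolynomial.aeval_X _ _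
  simp only [sectionPoly, affineForm, map_sub, map_sum, map_mul, hC, hX, Polynomial.toLaurent_C,
    toLaurent_coordPoly hd, Polynomial.toLaurent_X_pow, mul_sub, Finset.mul_sum]
  congr 1
  · exact Finset.sum_congr rfl fun i _ => by ring
  · ring

/-- After the shift by `d / 2`, only the highest harmonics, cosine and sine of `(d / 2) θ`, reach
the extreme exponents `0` and `d`; they sit at the indices `d / 2 - 1` and `d - 1`. -/
lemma coeff_coordPoly_top {d : ℕ} (hd : Even d) (i : Fin d) :
    (coordPoly d i).coeff d = (if (i : ℕ) + 1 = d / 2 then 1 / 2 else 0) +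
      if (i : ℕ) + 1 = d then -Complex.I / 2 else 0 := by
  have hi := i.2
  have h2 : d / 2 + d / 2 = d := by obtain ⟨m, rfl⟩ := hd; omega
  rw [coordPoly]
  split_ifs <;> simp only [Polynomial.coeff_C_mul, Polynomial.coeff_add, Polynomial.coeff_sub,
    Polynomial.coeff_X_pow] <;> split_ifs <;> first | contradiction | omega | ring1

lemma coeff_coordPoly_zero {d : ℕ} (hd : Even d) (i : Fin d) :
    (coordPoly d i).coeff 0 = (if (i : ℕ) + 1 = d / 2 then 1 / 2 else 0) +
      if (i : ℕ) + 1 = d then Complex.I / 2 else 0 := by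
  have hi := i.2
  have h2 : d / 2 + d / 2 = d := by obtain ⟨m, rfl⟩ := hd; omega
  rw [coordPoly]
  split_ifs <;> simp only [Polynomial.coeff_C_mul, Polynomial.coeff_add, Polynomial.coeff_sub,
    Polynomial.coeff_X_pow] <;> split_ifs <;> first | contradiction | omega | ring1

lemma natDegree_coordPoly_le {d : ℕ} (hd : Even d) (i : Fin d) :
    (coordPoly d i).natDegree ≤ d := by
  have hi := i.2
  have h2 : d / 2 + d / 2 = d := by obtain ⟨m, rfl⟩ := hd; omega
  have hX : ∀ k ≤ d, (Polynomial.X ^ k : Polynomial ℂ).natDegree ≤ d := fun k hk =>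
    (Polynomial.natDegree_X_pow_le k).trans hk
  rw [coordPoly]
  split_ifs
  · exact (Polynomial.natDegree_C_mul_le _ _).trans
      (Polynomial.natDegree_add_le_of_degree_le (hX _ (by omega)) (hX _ (by omega)))
  · exact (Polynomial.natDegree_C_mul_le _ _).trans
      (Polynomial.natDegree_sub_le_of_le (hX _ (by omega)) (hX _ (by omega)) |>.trans (by simp))

lemma natDegree_sectionPoly_le {d : ℕ} (hd : Even d) (a : Fin d → ℂ) (b : ℂ) :
    (sectionPoly a b).natDegree ≤ d := by
  refine (Polynomial.natDegree_sub_le_of_le (n := d) (m := d)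
    (Polynomial.natDegree_sum_le_of_forall_le _ _ fun i _ =>
      (Polynomial.natDegree_C_mul_le _ _).trans (natDegree_coordPoly_le hd i))
    ((Polynomial.natDegree_C_mul_le _ _).trans
      ((Polynomial.natDegree_X_pow_le _).trans (Nat.div_le_self d 2)))).trans (by simp)

lemma sum_mul_ite_succ_eq {d : ℕ} (a : Fin d → ℂ) (c s : Fin d) (x y : ℂ) :
    ∑ i : Fin d, a i * ((if (i : ℕ) + 1 = c + 1 then x else 0) +
      if (i : ℕ) + 1 = s + 1 then y else 0) = a c * x + a s * y := by
  simp [mul_add, Finset.sum_add_distrib, ← Fin.ext_iff]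

lemma coeff_sectionPoly {d : ℕ} (hd : Even d) (a : Fin d → ℂ) (b : ℂ) {c s : Fin d}
    (hc : (c : ℕ) + 1 = d / 2) (hs : (s : ℕ) + 1 = d) :
    (sectionPoly a b).coeff d = a c * (1 / 2) + a s * (-Complex.I / 2) ∧
      (sectionPoly a b).coeff 0 = a c * (1 / 2) + a s * (Complex.I / 2) := by
  constructor
  · rw [sectionPoly, Polynomial.coeff_sub, Polynomial.finsetSum_coeff,
      Polynomial.coeff_C_mul_X_pow, if_neg (by omega), sub_zero, ← sum_mul_ite_succ_eq a c s, hc,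
      hs]
    exact Finset.sum_congr rfl fun i _ => by rw [Polynomial.coeff_C_mul, coeff_coordPoly_top hd]
  · rw [sectionPoly, Polynomial.coeff_sub, Polynomial.finsetSum_coeff,
      Polynomial.coeff_C_mul_X_pow, if_neg (by omega), sub_zero, ← sum_mul_ite_succ_eq a c s, hc,
      hs]
    exact Finset.sum_congr rfl fun i _ => by rw [Polynomial.coeff_C_mul, coeff_coordPoly_zero hd]

theorem hasDegree_trigMomentCurve {d : ℕ} (hd : Even d) (hpos : 0 < d) :
    HasDegree (trigMomentCurve d) d := by
  have h2 : d / 2 + d / 2 = d := by obtain ⟨m, rfl⟩ := hd; omega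
  let c : Fin d := ⟨d / 2 - 1, by omega⟩
  let s : Fin d := ⟨d - 1, by omega⟩
  have hc : (c : ℕ) + 1 = d / 2 := by change d / 2 - 1 + 1 = _; omega
  have hs : (s : ℕ) + 1 = d := by change d - 1 + 1 = _; omega
  have hcs : c ≠ s := fun h => by rw [h] at hc; omega
  -- The genericity polynomial `a_c ^ 2 + a_s ^ 2` is four times the product of the extreme
  -- coefficients `(a_c - i a_s) / 2` and `(a_c + i a_s) / 2` of `sectionPoly`.
  refine ⟨1, dim_trigMomentCurve hd hpos,
    MvPolynomial.X (.inl (0, c)) ^ 2 + MvPolynomial.X (.inl (0, s)) ^ 2, ?_, ?_⟩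
  · intro h
    have := congrArg (MvPolynomial.eval
      (Sum.elim (fun ij => if ij.2 = c then 1 else 0) fun _ => 0)) h
    simp [hcs.symm] at this
  intro A b hQ
  simp only [map_add, map_pow, MvPolynomial.eval_X, Sum.elim_inl] at hQ
  obtain ⟨htop, hzero⟩ := coeff_sectionPoly hd (A 0) (b 0) hc hs
  have hprod : (sectionPoly (A 0) (b 0)).coeff d * (sectionPoly (A 0) (b 0)).coeff 0 ≠ 0 := by
    rw [htop, hzero]
    intro h
    apply hQ
    linear_combination 4 * h + (A 0 s) ^ 2 * Complex.I_mul_I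
  obtain ⟨htop, hzero⟩ := mul_ne_zero_iff.mp hprod
  have hdeg : (sectionPoly (A 0) (b 0)).natDegree = d :=
    Polynomial.natDegree_eq_of_le_of_coeff_ne_zero (natDegree_sectionPoly_le hd _ _) htop
  have hker : RingHom.ker (param d) ≤ sectionIdeal (trigMomentCurve d) A b := by
    rw [sectionIdeal, map_ideal_trigMomentCurve]
    exact le_sup_left
  have hmap : (sectionIdeal (trigMomentCurve d) A b).map (param d) =
      Ideal.span {param d (affineForm (A 0) (b 0))} := by
    rw [sectionIdeal, map_ideal_trigMomentCurve, Ideal.map_sup, Ideal.map_span,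
      (Ideal.map_eq_bot_iff_le_ker (param d)).mpr le_rfl, bot_sup_eq, Set.range_unique,
      Set.image_singleton]
    rfl
  obtain ⟨hfin, hsum⟩ := finsum_localMultiplicity (by omega) hker hmap
    (toLaurent_sectionPoly hd (A 0) (b 0)) hzero
  refine ⟨?_, hfin, by rw [hsum, hdeg]⟩
  -- A single row is independent as soon as it is nonzero, and a zero row would make the genericity
  -- polynomial vanish.
  refine LinearIndependent.of_subsingleton 0 fun h => hQ ?_
  simp [h]

end RealVariety

end

theorem proposition5p4 (d : ℕ) (hd : Even d) (hpos : 0 < d) :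
    RealVariety.IsVariety (RealVariety.trigMomentCurve d) ∧
    (∀ n : ℕ, RealVariety.hilbertFunction (RealVariety.trigMomentCurve d) n = n * d + 1) ∧
    RealVariety.dim (RealVariety.trigMomentCurve d) = 1 ∧
    RealVariety.HasDegree (RealVariety.trigMomentCurve d) d :=
  ⟨RealVariety.isVariety_trigMomentCurve hd hpos, RealVariety.hilbertFunction_trigMomentCurve hd,
    RealVariety.dim_trigMomentCurve hd hpos, RealVariety.hasDegree_trigMomentCurve hd hpos⟩
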